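/- An ordinal is a set with a transitive, extensional, wellfounded relation $<$ (extensional: elements with the same predecessors are equal). Ordinals are regarded as equal, written $=$, if there is a bijection between them that preserves and reflects the order; $\alpha\downarrow a$ is the initial segment $\{x\in\alpha : x<a\}$. The sum $\alpha+\beta$ is the disjoint union with $\alpha$ placed before $\beta$; the product $\alpha\times\beta$ is the cartesian product with $(a',b')<(a,b)$ iff $b'<b$, or $b'=b$ and $a'<a$. The supremum $\sup_{i\in I}F_i$ of a family of ordinals indexed by a set is the disjoint union $\coprod_{i}F_i$ modulo $(i,x)\sim(j,y)$ iff $F_i\downarrow x=F_j\downarrow y$, with $[i,x]<[j,y]$ iff $F_i\downarrow x$ is equal to a proper initial segment $(F_j\downarrow y)\downarrow z$; $\alpha\vee\beta$ is the supremum of the two-element family $\alpha,\beta$. A trichotomous least element of $\alpha$ is an element $\bot\in\alpha$ such that for every $x\in\alpha$ either $x=\bot$ or $\bot<x$. Theorem. Let $\alpha$ be an ordinal with a trichotomous least element $\bot$, and let $\alpha_{>\bot}=\{a\in\alpha : a>\bot\}$ with the inherited order. For an ordinal $\beta$ let $\exp(\alpha,\beta)$ be the set of finite lists $[(a_1,b_1),\dots,(a_n,b_n)]$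 of elements of $\alpha_{>\bot}\times\beta$ with $b_1>b_2>\dots>b_n$, ordered by the lexicographic order induced by the order of $\alpha_{>\bot}\times\beta$ (a proper prefix of a list being smaller than the list). Then, for every ordinal $\beta$, $\exp(\alpha,\beta)$ is an ordinal, with the empty list as a trichotomous least element, and it depends on $\beta$ only up to equality of ordinals. Moreover, for all ordinals $\beta$ and all families $(F_i)_{i\in I}$ of ordinals (indexed by an arbitrary, possibly empty, set $I$), $$\exp(\alpha,\beta+\mathbf 1)=\exp(\alpha,\beta)\times\alpha,\qquad \exp\bigl(\alpha,\sup_{i\in I}F_i\bigr)=\mathbf 1\vee\sup_{i\in I}\exp(\alpha,F_i).$$ Consequently $\exp(\alpha,-)$ also satisfies the usual specification of exponentiation: $\exp(\alpha,\mathbf 0)=\mathbf 1$; $\exp(\alpha,\beta+\mathbf 1)=\exp(\alpha,\beta)\times\alpha$; $\exp(\alpha,\sup_{i\in I}F_i)=\sup_{i\in I}\exp(\alpha,F_i)$ if $\alpha\neq\mathbf 0$ and $I$ is inhabited; and, if $\alpha=\mathbf 0$, $\exp(\alpha,\beta)=\mathbf 0$ for all $\beta\neq\mathbf 0$ (this last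 clause is vacuous here, as $\alpha$ has an element). -/

import Mathlib

universe u v w

/-- A relation is the order of an ordinal if it is transitive, extensional (elements with the same
predecessors are equal) and wellfounded. -/
structure IsOrdinal {A : Type u} (r : A → A → Prop) : Prop where
  trans : ∀ x y z, r x y → r y z → r x z
  ext : ∀ x y, (∀ z, r z x ↔ r z y) → x = y
  wf : WellFounded r

/-- An ordinal: a type with a transitive, extensional, wellfounded relation. -/
structure OrdType where
  carrier : Type u
  lt : carrier → carrier → Prop
  isOrdinal : IsOrdinal lt

theorem IsOrdinal.isWellOrder {A : Type u} {r : A → A → Prop} (h : IsOrdinal r) :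
    IsWellOrder A r := by
  have tri : ∀ x y, r x y ∨ x = y ∨ r y x := by
    intro x
    induction x using h.wf.induction with
    | _ x ihx =>
      intro y
      induction y using h.wf.induction with
      | _ y ihy =>
        by_contra hc
        push Not at hc
        obtain ⟨h1, h2, h3⟩ := hc
        refine h2 (h.ext x y fun z => ⟨fun hz => ?_, fun hz => ?_⟩)
        · rcases ihx z hz y with h4 | rfl | h4
          · exact h4
          · exact absurd hz h3
          · exact absurd (h.trans _ _ _ h4 hz) h3
        · rcases ihy z hz with h4 | rfl | h4
          · exact absurd (h.trans _ _ _ h4 hz) h1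
          · exact absurd hz h1
          · exact h4
  exact { wf := h.wf
          trichotomous := fun x y h1 h2 => (tri x y).resolve_left h1 |>.resolve_right h2 }

theorem IsOrdinal.of_isWellOrder {A : Type u} (r : A → A → Prop) [IsWellOrder A r] :
    IsOrdinal r where
  trans _ _ _ := trans_of r
  ext := fun x y hxy => by
    rcases trichotomous_of r x y with h | h | h
    · exact absurd ((hxy x).2 h) (irrefl_of r x)
    · exact h
    · exact absurd ((hxy y).1 h) (irrefl_of r y)
  wf := IsWellFounded.wf

namespace OrdType

instance (α : OrdType.{u}) : IsWellOrder α.carrier α.lt := α.isOrdinal.isWellOrder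

/-- Equality of ordinals: existence of an ordinal equivalence, i.e. of a bijection that preserves
and reflects the order. -/
def Equiv (α : OrdType.{u}) (β : OrdType.{v}) : Prop := Nonempty (α.lt ≃r β.lt)

/-- `0`. -/
def zero : OrdType.{u} := ⟨PEmpty, fun _ _ => False, ⟨by simp, by simp, ⟨fun a => a.elim⟩⟩⟩

/-- `1`. -/
def one : OrdType.{u} :=
  ⟨PUnit, fun _ _ => False, ⟨by simp, by simp, ⟨fun _ => ⟨_, fun _ h => h.elim⟩⟩⟩⟩

/-- The sum `α + β`: the disjoint union, `α` placed before `β`. -/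
def add (α : OrdType.{u}) (β : OrdType.{v}) : OrdType.{max u v} :=
  ⟨α.carrier ⊕ β.carrier, Sum.Lex α.lt β.lt, .of_isWellOrder _⟩

/-- The order on a product in which the second component is dominant. -/
def prodLt {A : Type u} {B : Type v} (r : A → A → Prop) (s : B → B → Prop) (p q : A × B) : Prop :=
  s p.2 q.2 ∨ (p.2 = q.2 ∧ r p.1 q.1)

theorem prodLt_isWellOrder {A : Type u} {B : Type v} (r : A → A → Prop) (s : B → B → Prop)
    [IsWellOrder A r] [IsWellOrder B s] : IsWellOrder (A × B) (prodLt r s) :=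
  RelEmbedding.isWellOrder (s := Prod.Lex s r)
    ⟨⟨Prod.swap, Prod.swap_injective⟩, by simp [prodLt, Prod.lex_def]⟩

/-- The product `α × β`, with `β` dominant. -/
def mul (α : OrdType.{u}) (β : OrdType.{v}) : OrdType.{max u v} :=
  ⟨α.carrier × β.carrier, prodLt α.lt β.lt,
    have := prodLt_isWellOrder α.lt β.lt
    .of_isWellOrder _⟩

/-- The initial segment `α ↓ a`. -/
def seg (α : OrdType.{u}) (a : α.carrier) : OrdType.{u} :=
  ⟨{x // α.lt x a}, fun x y => α.lt x.1 y.1,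
    have : IsWellOrder {x // α.lt x a} (fun x y => α.lt x.1 y.1) :=
      (Subrel.relEmbedding α.lt (α.lt · a)).isWellOrder
    .of_isWellOrder _⟩

/-- The strict order of ordinals: `α` is (equivalent to) an initial segment of `β`. -/
def Lt (α : OrdType.{u}) (β : OrdType.{v}) : Prop := ∃ b : β.carrier, α.Equiv (β.seg b)

theorem equiv_iff (α β : OrdType.{u}) : α.Equiv β ↔ Ordinal.type α.lt = Ordinal.type β.lt :=
  Ordinal.type_eq.symm

theorem lt_iff (α β : OrdType.{u}) : α.Lt β ↔ Ordinal.type α.lt < Ordinal.type β.lt := by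
  rw [← Ordinal.mem_range_typein_iff]
  refine exists_congr fun b => ?_
  rw [equiv_iff, eq_comm]
  rfl

section Sup

variable {I : Type v} (F : I → OrdType.{w})

/-- On the disjoint union of the `F i`: two elements are identified if they determine equal
initial segments. -/
def supSetoid : Setoid (Σ i, (F i).carrier) where
  r p q := ((F p.1).seg p.2).Equiv ((F q.1).seg q.2)
  iseqv := by
    simp only [equiv_iff]
    exact ⟨fun _ => rfl, fun h => h.symm, fun h h' => h.trans h'⟩

/-- The order on the quotient: compare the initial segments determined by representatives. -/
def supLt : Quotient (supSetoid F) → Quotient (supSetoid F) → Prop :=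
  Quotient.lift₂ (fun p q => ((F p.1).seg p.2).Lt ((F q.1).seg q.2)) (by
    intro p q p' q' h h'
    have h := (equiv_iff _ _).1 h
    have h' := (equiv_iff _ _).1 h'
    simp only [lt_iff, h, h'])

theorem supLt_isWellOrder : IsWellOrder _ (supLt F) := by
  let φ : Quotient (supSetoid F) → Ordinal.{w} :=
    Quotient.lift (fun p => Ordinal.type ((F p.1).seg p.2).lt) fun p q h => (equiv_iff _ _).1 h
  have hφ : Function.Injective φ := by
    rintro ⟨p⟩ ⟨q⟩ h
    exact Quotient.sound ((equiv_iff _ _).2 h)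
  have hwo : IsWellOrder Ordinal.{w} (· < ·) := ⟨⟩
  refine RelEmbedding.isWellOrder (s := (· < ·)) ⟨⟨φ, hφ⟩, ?_⟩
  rintro ⟨p⟩ ⟨q⟩
  exact (lt_iff _ _).symm

/-- The supremum of a family of ordinals. -/
def sup : OrdType.{max v w} :=
  ⟨Quotient (supSetoid F), supLt F,
    have := supLt_isWellOrder F
    .of_isWellOrder _⟩

end Sup

/-- The binary join `α ∨ β`: the supremum of the two-element family `α`, `β`. -/
def join (α β : OrdType.{u}) : OrdType.{u} := sup (fun b : Bool => if b then β else α)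

/-- `bot` is a trichotomous least element. (By wellfoundedness it then has no predecessors, so it
is a least element.) -/
def IsTrichotomousLeast (α : OrdType.{u}) (bot : α.carrier) : Prop :=
  ∀ x, x = bot ∨ α.lt bot x

/-- The subtype of elements strictly above `bot`. -/
def Pos (α : OrdType.{u}) (bot : α.carrier) : Type u := {a : α.carrier // α.lt bot a}

/-- Lists of pairs whose second components are (strictly) decreasing. -/
def DecrList (A : Type u) (β : OrdType.{v}) : Type (max u v) :=
  {l : List (A × β.carrier) // (l.map Prod.snd).Pairwise (fun b b' => β.lt b' b)}

/-- The underlying type of the concrete exponential `exp(α, β)`. -/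
def ExpCarrier (α : OrdType.{u}) (bot : α.carrier) (β : OrdType.{v}) : Type (max u v) :=
  DecrList (α.Pos bot) β

/-- The order on `exp(α, β)`: the lexicographic order on lists induced by the order of the
product of the positive elements of `α` with `β`. -/
def expLt (α : OrdType.{u}) (bot : α.carrier) (β : OrdType.{v}) (l l' : ExpCarrier α bot β) :
    Prop :=
  List.Lex (prodLt (fun a a' : α.Pos bot => α.lt a.1 a'.1) β.lt) l.1 l'.1

/-- The empty list, as an element of `exp(α, β)`. -/
def expNil (α : OrdType.{u}) (bot : α.carrier) (β : OrdType.{v}) : ExpCarrier α bot β :=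
  ⟨[], List.Pairwise.nil⟩

/-- The specification of an exponentiation `β ↦ E β` with base `α` by a successor clause and a
clause for the suprema of arbitrary (possibly empty) small families. -/
structure StrongExpSpec (α : OrdType.{u}) (E : OrdType.{v} → OrdType.{max u v}) : Prop where
  succ : ∀ β : OrdType.{v}, (E (β.add one.{v})).Equiv ((E β).mul α)
  sup : ∀ (I : Type v) (F : I → OrdType.{v}),
    (E (sup F)).Equiv (join one (OrdType.sup fun i => E (F i)))

/-- The classical specification of an exponentiation `β ↦ E β` with base `α`. -/
structure FullExpSpec (α : OrdType.{u}) (E : OrdType.{v} → OrdType.{max u v}) : Prop where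
  zero : (E zero).Equiv one.{max u v}
  succ : ∀ β : OrdType.{v}, (E (β.add one.{v})).Equiv ((E β).mul α)
  sup : ¬ α.Equiv OrdType.zero.{u} → ∀ (I : Type v) (F : I → OrdType.{v}), Nonempty I →
    (E (sup F)).Equiv (OrdType.sup fun i => E (F i))
  zero_base : α.Equiv OrdType.zero.{u} → ∀ β : OrdType.{v}, ¬ β.Equiv OrdType.zero.{v} →
    (E β).Equiv OrdType.zero.{max u v}

end OrdType

/-!
All equalities of ordinals are obtained from initial segment embeddings `r ≼i s`; between well-orders
these are unique, and a surjective one is an isomorphism.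

* The supremum of a family is the least upper bound for `≼i`: each `F i` embeds into `sup F`
  (`OrdType.toSup`), and initial segment embeddings `F i ≼i γ` glue to one `sup F ≼i γ`
  (`OrdType.supLift`). Hence `sup F = γ` as soon as the images of the `F i` cover `γ`
  (`OrdType.sup_equiv_of_cover`).
* The order of `exp(α, β)` is wellfounded because its elements are decreasing lists in a wellfounded
  order.
* The operation `exp(α, -)` acts on initial segment embeddings (`OrdType.expMap`), and a list over
  `γ` comes from a list over an initial segment of `γ` as soon as the exponent of its first entry
  does (`OrdType.exists_expMap_eq`), the exponents being decreasing.

Consequently a nonempty list over `sup F` comes from a list over the single `F i` containing its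
leading exponent, so the `exp(α, F i)` together with the empty list cover `exp(α, sup F)`. This is
the supremum clause; the empty list needs separate treatment only if the family is empty. For the
successor clause, a list over `β + 1` has the new top exponent at most at its head, and its
coefficient there, read as `⊥` if the exponent does not occur, is the second component of the
corresponding element of `exp(α, β) × α`.
-/

namespace OrdType

open scoped InitialSeg

/-! ### Initial segments -/

theorem Equiv.symm {α : OrdType.{u}} {β : OrdType.{v}} (h : α.Equiv β) : β.Equiv α :=
  h.map RelIso.symm

theorem Equiv.trans {α : OrdType.{u}} {β : OrdType.{v}} {γ : OrdType.{w}} (h : α.Equiv β)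
    (h' : β.Equiv γ) : α.Equiv γ :=
  h.elim fun e => h'.map e.trans

theorem seg_equiv_seg_iff (α : OrdType.{u}) {a b : α.carrier} :
    (α.seg a).Equiv (α.seg b) ↔ a = b :=
  (equiv_iff _ _).trans (Ordinal.typein_inj α.lt)

theorem seg_lt_seg_iff (α : OrdType.{u}) {a b : α.carrier} :
    (α.seg a).Lt (α.seg b) ↔ α.lt a b :=
  (lt_iff _ _).trans (Ordinal.typein_lt_typein α.lt)

/-- An initial segment embedding does not change the segment below an element. -/
theorem seg_equiv_seg_apply {α : OrdType.{u}} {β : OrdType.{v}} (f : α.lt ≼i β.lt)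
    (a : α.carrier) : (α.seg a).Equiv (β.seg (f a)) :=
  ⟨((PrincipalSeg.ofElement α.lt a).transInitial f).subrelIso.symm⟩

/-- The inclusion of an initial segment. -/
def segIncl (α : OrdType.{u}) (a : α.carrier) : (α.seg a).lt ≼i α.lt where
  toFun := Subtype.val
  inj' := Subtype.val_injective
  map_rel_iff' := Iff.rfl
  mem_range_of_rel' x y h := ⟨⟨y, α.isOrdinal.trans _ _ _ h x.2⟩, rfl⟩

theorem equiv_of_surjective {α : OrdType.{u}} {β : OrdType.{v}} (f : α.lt ≼i β.lt)
    (hf : Function.Surjective f) : α.Equiv β :=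
  ⟨RelIso.ofSurjective f.toRelEmbedding hf⟩

/-- A trichotomous least element, as an initial segment with one element. -/
def oneInitialSeg {α : OrdType.{u}} {bot : α.carrier} (h : α.IsTrichotomousLeast bot) :
    one.{v}.lt ≼i α.lt where
  toFun _ := bot
  inj' _ _ _ := rfl
  map_rel_iff' {_ _} := iff_of_false (irrefl_of α.lt bot) id
  mem_range_of_rel' _ y hy := (h y).elim (fun e => ⟨PUnit.unit, e.symm⟩)
    fun hy' => absurd hy' (asymm_of α.lt hy)

/-! ### Suprema -/

section Sup

variable {I : Type v} {F : I → OrdType.{w}} {γ : OrdType.{u}}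

/-- The embedding of a member of a family into the supremum. -/
def toSup (F : I → OrdType.{w}) (i : I) : (F i).lt ≼i (sup F).lt where
  toFun x := Quotient.mk (supSetoid F) ⟨i, x⟩
  inj' _ _ h := (seg_equiv_seg_iff _).1 (Quotient.exact h)
  map_rel_iff' := seg_lt_seg_iff _
  mem_range_of_rel' x := by
    rintro ⟨q⟩ ⟨z, hz⟩
    exact ⟨z.1, Quotient.sound (hz.trans (seg_equiv_seg_apply (segIncl _ _) z)).symm⟩

theorem exists_toSup_eq (x : (sup F).carrier) : ∃ i y, toSup F i y = x := by
  obtain ⟨⟨i, y⟩⟩ := x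
  exact ⟨i, y, rfl⟩

/-- Elements identified in the supremum have the same image in any common upper bound. -/
theorem apply_eq_of_seg_equiv (f : ∀ i, (F i).lt ≼i γ.lt) {i j : I} {x : (F i).carrier}
    {y : (F j).carrier} (h : ((F i).seg x).Equiv ((F j).seg y)) : f i x = f j y :=
  (seg_equiv_seg_iff γ).1
    (((seg_equiv_seg_apply (f i) x).symm.trans h).trans (seg_equiv_seg_apply (f j) y))

/-- The supremum is the least upper bound: initial segment embeddings of the members of a family
into `γ` glue to one of the supremum. -/
def supLift (f : ∀ i, (F i).lt ≼i γ.lt) : (sup F).lt ≼i γ.lt where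
  toRelEmbedding := RelEmbedding.ofMonotone
    (Quotient.lift (fun p : Σ i, (F i).carrier => f p.1 p.2)
      fun _ _ h => apply_eq_of_seg_equiv f h) (by
    rintro ⟨i, x⟩ ⟨j, y⟩ ⟨z, hz⟩
    have h : f i x = f j z.1 :=
      apply_eq_of_seg_equiv f (hz.trans (seg_equiv_seg_apply (segIncl _ _) z))
    change γ.lt (f i x) (f j y)
    exact h ▸ (f j).map_rel_iff.2 z.2)
  mem_range_of_rel' := by
    rintro ⟨i, x⟩ b hb
    obtain ⟨y, rfl⟩ := (f i).mem_range_of_rel hb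
    exact ⟨toSup F i y, rfl⟩

/-- An ordinal covered by a family of initial segments is their supremum. -/
theorem sup_equiv_of_cover (f : ∀ i, (F i).lt ≼i γ.lt) (hf : ∀ c, ∃ i x, f i x = c) :
    (sup F).Equiv γ :=
  equiv_of_surjective (supLift f) fun c =>
    let ⟨i, x, h⟩ := hf c
    ⟨toSup F i x, h⟩

/-- An ordinal covered by two initial segments is their join. -/
theorem join_equiv_of_cover {α β : OrdType.{w}} (f : α.lt ≼i γ.lt) (g : β.lt ≼i γ.lt)
    (h : ∀ c, (∃ x, f x = c) ∨ ∃ y, g y = c) : (join α β).Equiv γ :=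
  sup_equiv_of_cover (fun b => match b with
    | false => f
    | true => g) fun c => (h c).elim (fun ⟨x, hx⟩ => ⟨false, x, hx⟩) fun ⟨y, hy⟩ => ⟨true, y, hy⟩

end Sup

/-! ### The exponential as an ordinal -/

section Exp

variable (α : OrdType.{u}) (bot : α.carrier)

/-- The order on `Pos α bot × β` that induces the order of the exponential. -/
abbrev entryLt (β : OrdType.{v}) : α.Pos bot × β.carrier → α.Pos bot × β.carrier → Prop :=
  prodLt (fun a a' : α.Pos bot => α.lt a.1 a'.1) β.lt

instance (β : OrdType.{v}) : IsWellOrder _ (entryLt α bot β) :=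
  have : IsWellOrder (α.Pos bot) (fun a a' => α.lt a.1 a'.1) :=
    (Subrel.relEmbedding α.lt (α.lt bot ·)).isWellOrder
  prodLt_isWellOrder _ _

theorem expLt_isWellOrder (β : OrdType.{v}) : IsWellOrder _ (expLt α bot β) where
  wf := by
    -- The entries of a list with decreasing exponents form a decreasing chain.
    let f (l : ExpCarrier α bot β) : List.chains (entryLt α bot β) :=
      ⟨l.1, ((List.pairwise_map.1 l.2).imp fun h => Or.inl h).isChain⟩
    exact InvImage.wf f (IsWellFounded.wf (r := entryLt α bot β)).list_chain'
  trichotomous l l' h h' :=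
    Subtype.ext (Std.Trichotomous.trichotomous (r := List.Lex (entryLt α bot β)) _ _ h h')

/-- The concrete exponential `exp(α, β)`, as an ordinal. -/
def exp (β : OrdType.{v}) : OrdType.{max u v} :=
  ⟨ExpCarrier α bot β, expLt α bot β,
    have := expLt_isWellOrder α bot β
    .of_isWellOrder _⟩

theorem expNil_isTrichotomousLeast (β : OrdType.{v}) :
    (exp α bot β).IsTrichotomousLeast (expNil α bot β) := by
  rintro ⟨_ | ⟨p, l⟩, hl⟩
  · exact Or.inl rfl
  · exact Or.inr List.Lex.nil

variable {α bot}

/-! ### Functoriality in the exponent -/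

section Map

variable {β : OrdType.{v}} {γ : OrdType.{w}} (f : β.lt ≼i γ.lt)

/-- The action of an initial segment embedding on the exponents of a list. -/
def expMapFun (l : ExpCarrier α bot β) : ExpCarrier α bot γ :=
  ⟨l.1.map (Prod.map id f), by
    have := l.2
    simp only [List.pairwise_map] at this ⊢
    exact this.imp fun h => f.map_rel_iff.2 h⟩

theorem expMapFun_lt {l l' : ExpCarrier α bot β} (h : expLt α bot β l l') :
    expLt α bot γ (expMapFun f l) (expMapFun f l') := by
  obtain ⟨l, hl⟩ := l
  obtain ⟨l', hl'⟩ := l'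
  change List.Lex _ l l' at h
  change List.Lex _ (l.map (Prod.map id f)) (l'.map (Prod.map id f))
  clear hl hl'
  induction h with
  | nil => exact .nil
  | cons _ ih => exact .cons ih
  | rel h => exact .rel (h.imp f.map_rel_iff.2 (And.imp_left (congrArg f)))

/-- As the exponents decrease, a list comes from an initial segment as soon as the exponent of its
first entry does. -/
theorem exists_expMap_eq (l : ExpCarrier α bot γ) (h : ∀ p ∈ l.1.head?, p.2 ∈ Set.range f) :
    ∃ l', expMapFun f l' = l := by
  obtain ⟨l, hl⟩ := l
  have hmem : ∀ p ∈ l, p.2 ∈ Set.range f := by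
    cases l with
    | nil => simp
    | cons q t =>
      obtain ⟨b, hb⟩ := h q rfl
      have hl := List.pairwise_cons.1 (List.pairwise_map.1 hl)
      intro p hp
      rcases List.mem_cons.1 hp with rfl | hp
      · exact ⟨b, hb⟩
      · exact f.mem_range_of_rel (a := b) (hb ▸ hl.1 p hp)
  have hr : l ∈ Set.range (List.map (Prod.map (id : α.Pos bot → _) f)) := by
    rw [Set.range_list_map]
    intro p hp
    obtain ⟨b, hb⟩ := hmem p hp
    exact ⟨(p.1, b), Prod.ext rfl hb⟩
  obtain ⟨l', rfl⟩ := hr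
  refine ⟨⟨l', ?_⟩, rfl⟩
  simp only [List.pairwise_map] at hl ⊢
  exact hl.imp fun h => f.map_rel_iff.1 h

/-- The exponential is functorial for initial segment embeddings of the exponent. -/
def expMap : (exp α bot β).lt ≼i (exp α bot γ).lt where
  toRelEmbedding := RelEmbedding.ofMonotone (expMapFun f) fun _ _ => expMapFun_lt f
  mem_range_of_rel' := by
    rintro ⟨l, hl⟩ ⟨m, hm⟩ h
    refine exists_expMap_eq f ⟨m, hm⟩ ?_
    cases m with
    | nil => simp
    | cons p m =>
      rintro _ ⟨⟩
      cases l with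
      | nil => cases h
      | cons q l =>
        cases h with
        | cons => exact ⟨_, rfl⟩
        | rel h =>
          rcases h with h | ⟨h, -⟩
          · exact f.mem_range_of_rel h
          · exact ⟨_, h.symm⟩

end Map

theorem exp_congr {β γ : OrdType.{v}} (h : β.Equiv γ) : (exp α bot β).Equiv (exp α bot γ) :=
  h.map fun e => (expMap e.toInitialSeg).antisymm (expMap e.symm.toInitialSeg)

theorem exp_zero : (exp α bot zero.{v}).Equiv one.{max u v} :=
  (equiv_of_surjective (oneInitialSeg (expNil_isTrichotomousLeast α bot zero)) fun l => by
    obtain ⟨_ | ⟨p, l⟩, hl⟩ := l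
    · exact ⟨PUnit.unit, rfl⟩
    · exact p.2.elim).symm

/-! ### The supremum clause -/

section Sup

variable {I : Type v} (F : I → OrdType.{v})

theorem eq_nil_or_exists_expMap_toSup_eq (l : (exp α bot (sup F)).carrier) :
    l = expNil α bot (sup F) ∨ ∃ i l', expMap (toSup F i) l' = l := by
  obtain ⟨_ | ⟨p, t⟩, hl⟩ := l
  · exact Or.inl rfl
  · obtain ⟨i, y, hy⟩ := exists_toSup_eq p.2
    refine Or.inr ⟨i, exists_expMap_eq (toSup F i) ⟨p :: t, hl⟩ ?_⟩
    rintro _ ⟨⟩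
    exact ⟨y, hy⟩

theorem exp_sup :
    (exp α bot (sup F)).Equiv (join one (sup fun i => exp α bot (F i))) := by
  refine (join_equiv_of_cover (oneInitialSeg (expNil_isTrichotomousLeast α bot (sup F)))
    (supLift fun i => expMap (toSup F i)) fun l => ?_).symm
  rcases eq_nil_or_exists_expMap_toSup_eq F l with h | ⟨i, l', h⟩
  · exact Or.inl ⟨PUnit.unit, h.symm⟩
  · exact Or.inr ⟨toSup _ i l', h⟩

theorem exp_sup_of_nonempty [Nonempty I] :
    (exp α bot (sup F)).Equiv (sup fun i => exp α bot (F i)) := by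
  refine (sup_equiv_of_cover (fun i => expMap (toSup F i)) fun l => ?_).symm
  rcases eq_nil_or_exists_expMap_toSup_eq F l with rfl | h
  · obtain ⟨i⟩ := ‹Nonempty I›
    exact ⟨i, expNil α bot (F i), rfl⟩
  · exact h

end Sup

/-! ### The successor clause -/

section Succ

variable (β : OrdType.{v})

/-- The inclusion of `β` into `β + 1`. -/
abbrev toSucc : β.lt ≼i (β.add one.{v}).lt :=
  InitialSeg.leAdd _ _

open Classical in
/-- The list over `β + 1` with the given coefficient at the top exponent, followed by the given list
over `β`. The coefficient `⊥` stands for the absence of the top exponent. -/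
noncomputable def consTop (hbot : α.IsTrichotomousLeast bot) (p : ExpCarrier α bot β × α.carrier) :
    ExpCarrier α bot (β.add one.{v}) :=
  if h : p.2 = bot then expMapFun (toSucc β) p.1
  else ⟨(⟨p.2, (hbot p.2).resolve_left h⟩, Sum.inr PUnit.unit) :: (expMapFun (toSucc β) p.1).1, by
    refine List.pairwise_cons.2 ⟨?_, (expMapFun (toSucc β) p.1).2⟩
    simp only [expMapFun, List.map_map, List.mem_map]
    rintro _ ⟨q, -, rfl⟩
    exact Sum.Lex.sep _ _⟩

theorem consTop_bot (hbot : α.IsTrichotomousLeast bot) (l : ExpCarrier α bot β) :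
    consTop β hbot (l, bot) = expMapFun (toSucc β) l :=
  dif_pos rfl

theorem consTop_val_of_lt (hbot : α.IsTrichotomousLeast bot) (l : ExpCarrier α bot β)
    {a : α.carrier} (ha : α.lt bot a) :
    (consTop β hbot (l, a)).1 = (⟨a, ha⟩, Sum.inr PUnit.unit) :: (expMapFun (toSucc β) l).1 := by
  have h : a ≠ bot := fun h => irrefl_of α.lt bot (by rwa [h] at ha)
  exact congrArg Subtype.val (dif_neg h)

theorem consTop_lt (hbot : α.IsTrichotomousLeast bot) {p q : ExpCarrier α bot β × α.carrier}
    (h : prodLt (expLt α bot β) α.lt p q) :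
    expLt α bot (β.add one.{v}) (consTop β hbot p) (consTop β hbot q) := by
  obtain ⟨l, a⟩ := p
  obtain ⟨l', a'⟩ := q
  rcases h with (h : α.lt a a') | ⟨rfl : a = a', h⟩
  · rcases hbot a with rfl | ha
    · rw [expLt, consTop_bot, consTop_val_of_lt _ _ _ h]
      obtain ⟨_ | ⟨x, t⟩, hl⟩ := l
      · exact .nil
      · exact .rel (Or.inl (Sum.Lex.sep _ _))
    · rw [expLt, consTop_val_of_lt _ _ _ ha,
        consTop_val_of_lt _ _ _ (α.isOrdinal.trans _ _ _ ha h)]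
      exact .rel (Or.inr ⟨rfl, h⟩)
  · rcases hbot a with rfl | ha
    · rw [consTop_bot, consTop_bot]
      exact expMapFun_lt _ h
    · rw [expLt, consTop_val_of_lt _ _ _ ha, consTop_val_of_lt _ _ _ ha]
      exact .cons (expMapFun_lt (toSucc β) h)

theorem consTop_surjective (hbot : α.IsTrichotomousLeast bot) :
    Function.Surjective (consTop β hbot) := by
  have low (l : ExpCarrier α bot (β.add one.{v}))
      (hl : ∀ p ∈ l.1.head?, p.2 ∈ Set.range (toSucc β)) : ∃ p, consTop β hbot p = l := by
    obtain ⟨l', rfl⟩ := exists_expMap_eq (toSucc β) l hl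
    exact ⟨(l', bot), consTop_bot β hbot l'⟩
  rintro ⟨_ | ⟨⟨a, b | ⟨⟩⟩, t⟩, hl⟩
  · exact low _ (by simp)
  · refine low _ ?_
    rintro _ ⟨⟩
    exact ⟨b, rfl⟩
  · have hl' := List.pairwise_cons.1 hl
    obtain ⟨l', hl''⟩ : ∃ l', expMapFun (toSucc β) l' = ⟨t, hl'.2⟩ := by
      refine exists_expMap_eq _ _ fun p hp => ?_
      have hlt := hl'.1 _ (List.mem_map_of_mem (List.mem_of_mem_head? hp))
      obtain ⟨c, b | ⟨⟩⟩ := p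
      · exact ⟨b, rfl⟩
      · exact absurd hlt (irrefl_of (β.add one.{v}).lt _)
    exact ⟨(l', a.1), Subtype.ext ((consTop_val_of_lt β hbot l' a.2).trans
      (congrArg (_ :: ·) (congrArg Subtype.val hl'')))⟩

theorem exp_succ (hbot : α.IsTrichotomousLeast bot) :
    (exp α bot (β.add one.{v})).Equiv ((exp α bot β).mul α) :=
  Equiv.symm ⟨RelIso.ofSurjective
    (r := ((exp α bot β).mul α).lt) (s := (exp α bot (β.add one.{v})).lt)
    (RelEmbedding.ofMonotone (consTop β hbot) fun _ _ => consTop_lt β hbot)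
    (consTop_surjective β hbot)⟩

end Succ

end Exp

end OrdType

theorem theorem24 (α : OrdType.{u}) (bot : α.carrier) (hbot : α.IsTrichotomousLeast bot) :
    ∃ hexp : ∀ β : OrdType.{v}, IsOrdinal (OrdType.expLt α bot β),
      -- in the following, the exponential is an ordinal, as an operation on its exponent
      let exp : OrdType.{v} → OrdType.{max u v} := fun β =>
        ⟨OrdType.ExpCarrier α bot β, OrdType.expLt α bot β, hexp β⟩
      (∀ β, (exp β).IsTrichotomousLeast (OrdType.expNil α bot β)) ∧
      (∀ β γ, β.Equiv γ → (exp β).Equiv (exp γ)) ∧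
      OrdType.StrongExpSpec α exp ∧
      OrdType.FullExpSpec α exp :=
  ⟨fun β => (OrdType.exp α bot β).isOrdinal, OrdType.expNil_isTrichotomousLeast α bot,
    fun _ _ h => OrdType.exp_congr h,
    { succ := fun β => OrdType.exp_succ β hbot
      sup := fun _ F => OrdType.exp_sup F },
    { zero := OrdType.exp_zero
      succ := fun β => OrdType.exp_succ β hbot
      sup := fun _ _ F _ => OrdType.exp_sup_of_nonempty F
      zero_base := fun ⟨e⟩ => (e bot).elim }⟩
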